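/- Let $R$ be an associative unital ring, not necessarily commutative. An $R$-complex is a (possibly unbounded) $\mathbb{Z}$-indexed complex of left $R$-modules. Write $\otimes_R$ and $\operatorname{Hom}_R$ for the total tensor product complex and the total Hom complex. An $R$-complex $F$ is called semi-flat if every module in $F$ is flat and $M\otimes_R F$ is acyclic for every acyclic complex $M$ of right $R$-modules. A complex $N$ is called bounded if only finitely many of its modules are non-zero, and degreewise finitely presented if each of its modules is a finitely presented $R$-module. Let $\alpha\colon F\to F'$ be a quasi-isomorphism between semi-flat $R$-complexes. Then for every bounded and degreewise finitely presented $R$-complex $N$ the morphism of complexes of abelian groups $$\operatorname{Hom}_R(N,\alpha)\colon \operatorname{Hom}_R(N,F)\longrightarrow \operatorname{Hom}_R(N,F')$$ is a quasi-isomorphism. -/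

import Mathlib

open CategoryTheory TensorProduct

universe u

section BalancedTensorProduct

variable (R : Type u) [Ring R]

/-- The subgroup of `M ⊗[ℤ] N` generated by the elements `mr ⊗ n - m ⊗ rn`, for a right
`R`-module `M` (that is, a module over `Rᵐᵒᵖ`, with `mr = op r • m`) and a left `R`-module `N`. -/
def balancedRel (M N : Type u) [AddCommGroup M] [Module Rᵐᵒᵖ M] [AddCommGroup N] [Module R N] :
    AddSubgroup (M ⊗[ℤ] N) :=
  AddSubgroup.closure
    {x | ∃ (m : M) (r : R) (n : N), x = (MulOpposite.op r • m) ⊗ₜ[ℤ] n - m ⊗ₜ[ℤ] (r • n)}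

/-- The tensor product `M ⊗_R N` of a right and a left module over a ring `R` which need not be
commutative. -/
abbrev BalancedTensor (M N : Type u) [AddCommGroup M] [Module Rᵐᵒᵖ M] [AddCommGroup N]
    [Module R N] : Type u :=
  (M ⊗[ℤ] N) ⧸ balancedRel R M N

variable {M M' N N' : Type u} [AddCommGroup M] [Module Rᵐᵒᵖ M] [AddCommGroup M'] [Module Rᵐᵒᵖ M']
  [AddCommGroup N] [Module R N] [AddCommGroup N'] [Module R N']

variable {R}

/-- The homomorphism `f ⊗_R g : M ⊗_R N → M' ⊗_R N'`, `m ⊗ n ↦ f m ⊗ g n`. -/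
def BalancedTensor.map (f : M →ₗ[Rᵐᵒᵖ] M') (g : N →ₗ[R] N') :
    BalancedTensor R M N →+ BalancedTensor R M' N' :=
  QuotientAddGroup.map _ _
    (TensorProduct.map f.toAddMonoidHom.toIntLinearMap g.toAddMonoidHom.toIntLinearMap).toAddMonoidHom
    (by
      rw [balancedRel, AddSubgroup.closure_le]
      rintro _ ⟨m, r, n, rfl⟩
      refine AddSubgroup.subset_closure ⟨f m, r, g n, ?_⟩
      simp)

lemma BalancedTensor.map_mk_tmul (f : M →ₗ[Rᵐᵒᵖ] M') (g : N →ₗ[R] N') (m : M) (n : N) :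
    BalancedTensor.map f g (QuotientAddGroup.mk (m ⊗ₜ[ℤ] n)) =
      QuotientAddGroup.mk (f m ⊗ₜ[ℤ] g n) := rfl

lemma BalancedTensor.hom_ext {A : Type u} [AddCommGroup A] {φ ψ : BalancedTensor R M N →+ A}
    (h : ∀ (m : M) (n : N), φ (QuotientAddGroup.mk (m ⊗ₜ[ℤ] n)) =
      ψ (QuotientAddGroup.mk (m ⊗ₜ[ℤ] n))) : φ = ψ := by
  refine QuotientAddGroup.addMonoidHom_ext _ (AddMonoidHom.ext fun x => ?_)
  induction x using TensorProduct.induction_on with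
  | zero => simp
  | tmul m n => exact h m n
  | add x y hx hy => rw [map_add, map_add, hx, hy]

end BalancedTensorProduct

section TensorComplex

variable (R : Type u) [Ring R]

/-- The bifunctor `(M, N) ↦ M ⊗_R N` from right and left `R`-modules to abelian groups. -/
noncomputable def balancedTensorFunctor :
    ModuleCat.{u} Rᵐᵒᵖ ⥤ ModuleCat.{u} R ⥤ AddCommGrpCat.{u} where
  obj M :=
    { obj N := AddCommGrpCat.of (BalancedTensor R M N)
      map g := AddCommGrpCat.ofHom (BalancedTensor.map LinearMap.id g.hom)
      map_id N := by
        ext : 1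
        exact BalancedTensor.hom_ext fun _ _ => rfl
      map_comp g g' := by
        ext : 1
        exact BalancedTensor.hom_ext fun _ _ => rfl }
  map f :=
    { app N := AddCommGrpCat.ofHom (BalancedTensor.map f.hom LinearMap.id)
      naturality N N' g := by
        ext : 1
        exact BalancedTensor.hom_ext fun _ _ => rfl }
  map_id M := by
    ext N : 3
    exact BalancedTensor.hom_ext fun _ _ => rfl
  map_comp f f' := by
    ext N : 3
    exact BalancedTensor.hom_ext fun _ _ => rfl

instance : (balancedTensorFunctor R).PreservesZeroMorphisms where
  map_zero M M' := by
    ext N : 3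
    refine BalancedTensor.hom_ext fun m n => ?_
    change QuotientAddGroup.mk ((0 : M') ⊗ₜ[ℤ] n) = (0 : BalancedTensor R M' N)
    rw [TensorProduct.zero_tmul]
    rfl

instance (M : ModuleCat.{u} Rᵐᵒᵖ) :
    ((balancedTensorFunctor R).obj M).PreservesZeroMorphisms where
  map_zero N N' := by
    ext : 1
    refine BalancedTensor.hom_ext fun m n => ?_
    change QuotientAddGroup.mk (m ⊗ₜ[ℤ] (0 : N')) = (0 : BalancedTensor R M N')
    rw [TensorProduct.tmul_zero]
    rfl

variable {R}

/-- The total tensor product `M ⊗_R F` of a complex of right `R`-modules and a complex of left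
`R`-modules: in degree `n` it is `⨁_{p + q = n} M^p ⊗_R F^q`, with differential
`m ⊗ x ↦ d m ⊗ x + (-1)^p m ⊗ d x` for `m` of degree `p`. -/
noncomputable def tensorComplex (M : CochainComplex (ModuleCat.{u} Rᵐᵒᵖ) ℤ)
    (F : CochainComplex (ModuleCat.{u} R) ℤ) : CochainComplex AddCommGrpCat.{u} ℤ :=
  HomologicalComplex.mapBifunctor M F (balancedTensorFunctor R) (ComplexShape.up ℤ)

/-- A left `R`-module `N` is flat if `- ⊗_R N` preserves injectivity of homomorphisms of right
`R`-modules. (Mathlib's `Module.Flat` is restricted to commutative rings.) -/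
def IsFlatModule (N : ModuleCat.{u} R) : Prop :=
  ∀ ⦃M M' : ModuleCat.{u} Rᵐᵒᵖ⦄ (f : M ⟶ M'), Function.Injective f →
    Function.Injective (BalancedTensor.map (R := R) f.hom (LinearMap.id : N →ₗ[R] N))

/-- A complex `F` of left `R`-modules is semi-flat if it consists of flat modules and the functor
`- ⊗_R F` preserves acyclicity. -/
structure IsSemiFlat (F : CochainComplex (ModuleCat.{u} R) ℤ) : Prop where
  flat : ∀ n : ℤ, IsFlatModule (F.X n)
  acyclic_tensor : ∀ M : CochainComplex (ModuleCat.{u} Rᵐᵒᵖ) ℤ,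
    M.Acyclic → (tensorComplex M F).Acyclic

/-- A complex is bounded if it vanishes outside a bounded interval of degrees. -/
def IsBoundedComplex (N : CochainComplex (ModuleCat.{u} R) ℤ) : Prop :=
  ∃ a b : ℤ, ∀ n : ℤ, n < a ∨ b < n → Limits.IsZero (N.X n)

end TensorComplex

/-- The morphism `Hom(N, α) : Hom(N, F) ⟶ Hom(N, F')` of total Hom complexes given by
postcomposition with `α`. -/
noncomputable def homComplexMap {R : Type u} [Ring R] (N : CochainComplex (ModuleCat.{u} R) ℤ)
    {F F' : CochainComplex (ModuleCat.{u} R) ℤ} (α : F ⟶ F') :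
    CochainComplex.HomComplex N F ⟶ CochainComplex.HomComplex N F' where
  f n := AddCommGrpCat.ofHom
    { toFun := fun z => z.comp (CochainComplex.HomComplex.Cochain.ofHom α) (add_zero n)
      map_zero' := CochainComplex.HomComplex.Cochain.zero_comp _ _
      map_add' := fun z z' => CochainComplex.HomComplex.Cochain.add_comp z z' _ _ }
  comm' i j _ := by
    ext z : 2
    exact CochainComplex.HomComplex.δ_comp_ofHom (n := i) z α j

/-! Write `N⁺` for the character module `Hom_ℤ(N, ℚ/ℤ)`, and let `C` be the mapping cone of `α`. The
pairing `Hom(K, F⁺) ≅ (K ⊗ F)⁺` turns preservation of acyclicity by `- ⊗ F` into K-injectivity of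
`F⁺` (`isKInjective_characterDualComplex`). Hence `C⁺`, built from `F⁺` and `F'⁺` by a triangle, is
K-injective. It is also acyclic, because `C` is acyclic and `ℚ/ℤ` is injective, so it is
contractible.

A contraction of `C⁺` says that `C` is pure acyclic: every map from a finitely presented module to
the cycles of `C` lifts along the differential (`exists_lift_of_characterDual_contraction`). For `N`
bounded and degreewise finitely presented, such lifts, chosen one degree at a time from the top,
make every cocycle from `N` to `C` a coboundary (`exists_δ_eq_of_exists_lift`). Reading this through
the two components of the cone gives bijectivity of `Hom(N, α)` on cohomology. -/

/-! ### Character modules and lifting from finitely presented modules -/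

section CharacterDual

/-- The group `ℚ/ℤ`, lifted to an arbitrary universe. -/
abbrev RatCircle : Type u := ULift.{u} (AddCircle (1 : ℚ))

/-- The group `Hom_ℤ(N, ℚ/ℤ)` of characters of an abelian group `N`. -/
def CharacterDual (N : Type u) [AddCommGroup N] : Type u := N →+ RatCircle.{u}

namespace CharacterDual

variable {N : Type u} [AddCommGroup N]

instance : AddCommGroup (CharacterDual N) := inferInstanceAs (AddCommGroup (N →+ RatCircle.{u}))

instance : FunLike (CharacterDual N) N RatCircle.{u} :=
  inferInstanceAs (FunLike (N →+ RatCircle.{u}) N RatCircle.{u})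

instance : AddMonoidHomClass (CharacterDual N) N RatCircle.{u} :=
  inferInstanceAs (AddMonoidHomClass (N →+ RatCircle.{u}) N RatCircle.{u})

@[ext] lemma ext {φ ψ : CharacterDual N} (h : ∀ x, φ x = ψ x) : φ = ψ := DFunLike.ext _ _ h

@[simp] lemma add_apply (φ ψ : CharacterDual N) (x : N) : (φ + ψ) x = φ x + ψ x := rfl

@[simp] lemma neg_apply (φ : CharacterDual N) (x : N) : (-φ) x = -φ x := rfl

/-- Characters are additive maps. -/
def toHom : CharacterDual N ≃+ (N →+ RatCircle.{u}) := AddEquiv.refl _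

@[simp] lemma toHom_apply (φ : CharacterDual N) (x : N) : toHom φ x = φ x := rfl

@[simp] lemma sum_apply {ι : Type*} (s : Finset ι) (φ : ι → CharacterDual N) (x : N) :
    (∑ i ∈ s, φ i) x = ∑ i ∈ s, φ i x := by
  simp only [← toHom_apply, map_sum, AddMonoidHom.finsetSum_apply]

variable {R : Type u} [Ring R] [Module R N]

/-- The right module structure on the characters of a left module. -/
instance : Module Rᵐᵒᵖ (CharacterDual N) where
  smul r φ := toHom.symm ((toHom φ).comp (DistribSMul.toAddMonoidHom N r.unop))
  one_smul φ := CharacterDual.ext fun x => congrArg φ (one_smul R x)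
  mul_smul r s φ := CharacterDual.ext fun x => congrArg φ (mul_smul s.unop r.unop x)
  smul_zero r := rfl
  smul_add r φ ψ := rfl
  add_smul r s φ := by
    refine CharacterDual.ext fun x => ?_
    exact (congrArg φ (add_smul r.unop s.unop x)).trans (map_add φ _ _)
  zero_smul φ := CharacterDual.ext fun x => (congrArg φ (zero_smul R x)).trans (map_zero φ)

@[simp] lemma smul_apply (r : Rᵐᵒᵖ) (φ : CharacterDual N) (x : N) :
    (r • φ) x = φ (r.unop • x) := rfl

variable {N' : Type u} [AddCommGroup N'] [Module R N']

/-- Precomposition of characters with a homomorphism. -/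
def map (f : N →ₗ[R] N') : CharacterDual N' →ₗ[Rᵐᵒᵖ] CharacterDual N where
  toFun φ := toHom.symm ((toHom φ).comp f.toAddMonoidHom)
  map_add' _ _ := rfl
  map_smul' r φ := CharacterDual.ext fun x => congrArg φ (f.map_smul r.unop x).symm

@[simp] lemma map_apply (f : N →ₗ[R] N') (φ : CharacterDual N') (x : N) :
    map f φ x = φ (f x) := rfl

/-- Characters separate points. -/
lemma exists_apply_ne_zero {x : N} (hx : x ≠ 0) : ∃ φ : CharacterDual N, φ x ≠ 0 := by
  obtain ⟨c, hc⟩ := CharacterModule.exists_character_apply_ne_zero_of_ne_zero hx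
  refine ⟨toHom.symm ((AddEquiv.ulift (α := AddCircle (1 : ℚ))).symm.toAddMonoidHom.comp
    (show N →+ AddCircle (1 : ℚ) from c)), fun h => hc ?_⟩
  exact (AddEquiv.ulift (α := AddCircle (1 : ℚ))).symm.injective (h.trans (map_zero _).symm)

/-- Characters separate points from subgroups. -/
lemma exists_vanishing_apply_ne_zero (H : AddSubgroup N) {x : N} (hx : x ∉ H) :
    ∃ φ : CharacterDual N, (∀ y ∈ H, φ y = 0) ∧ φ x ≠ 0 := by
  have hx' : (QuotientAddGroup.mk x : N ⧸ H) ≠ 0 := by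
    rwa [Ne, QuotientAddGroup.eq_zero_iff]
  obtain ⟨φ, hφ⟩ := exists_apply_ne_zero hx'
  refine ⟨toHom.symm ((toHom φ).comp (QuotientAddGroup.mk' H)), fun y hy => ?_, hφ⟩
  change φ (QuotientAddGroup.mk y) = 0
  rw [(QuotientAddGroup.eq_zero_iff y).2 hy, map_zero]

end CharacterDual

open CharacterDual in
/-- If the character duals of `A → B → E` admit a contraction at `B`, then homomorphisms from
finitely presented modules to the kernel of `B → E` lift to `A`. -/
lemma exists_lift_of_characterDual_contraction {R : Type u} [Ring R] {A B E N : Type u}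
    [AddCommGroup A] [Module R A] [AddCommGroup B] [Module R B] [AddCommGroup E] [Module R E]
    [AddCommGroup N] [Module R N] (d : A →ₗ[R] B) (e : B →ₗ[R] E)
    (s : CharacterDual A →ₗ[Rᵐᵒᵖ] CharacterDual B) (t : CharacterDual B → CharacterDual E)
    (hst : ∀ φ : CharacterDual B, φ = s (map d φ) + map e (t φ))
    [Module.FinitePresentation R N] (f : N →ₗ[R] B) (hf : e ∘ₗ f = 0) :
    ∃ g : N →ₗ[R] A, d ∘ₗ g = f := by
  classical
  obtain ⟨n, m, p, r, hp, hrp⟩ := Module.FinitePresentation.exists_fin' R N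
  let a : Fin m → Fin n → R := fun j i => r (Pi.single j 1) i
  let x : Fin n → B := fun i => f (p (Pi.single i 1))
  have hp_eq (v : Fin n → R) : p v = ∑ i, v i • p (Pi.single i 1) := by
    conv_lhs => rw [pi_eq_sum_univ' v]
    simp only [map_sum, map_smul]
  have hx (j : Fin m) : ∑ i, a j i • x i = 0 := by
    have : p (r (Pi.single j 1)) = 0 := (hrp _).2 ⟨_, rfl⟩
    rw [hp_eq] at this
    simpa [map_sum] using congrArg f this
  -- `f` amounts to the tuple `x` subject to the relations `a`; a lift of `f` is a tuple `y` with `Φ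
  -- y = (x, 0)`.
  let Φ : (Fin n → A) →+ (Fin n → B) × (Fin m → A) :=
    { toFun y := (fun i => d (y i), fun j => ∑ i, a j i • y i)
      map_zero' := by ext <;> simp
      map_add' y z := by ext <;> simp [Finset.sum_add_distrib] }
  have key : ((x, 0) : (Fin n → B) × (Fin m → A)) ∈ Φ.range := by
    -- Otherwise a character `χ` kills the range of `Φ` but not `(x, 0)`; `φ i` and `ψ j` are its
    -- components.
    by_contra hx'
    obtain ⟨χ, hχ, hχx⟩ := exists_vanishing_apply_ne_zero _ hx'
    let φ (i : Fin n) : CharacterDual B := toHom.symm ((toHom χ).comp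
      ((AddMonoidHom.inl _ _).comp (AddMonoidHom.single (fun _ => B) i)))
    let ψ (j : Fin m) : CharacterDual A := toHom.symm ((toHom χ).comp
      ((AddMonoidHom.inr _ _).comp (AddMonoidHom.single (fun _ => A) j)))
    have hχφ (y : Fin n → B) (z : Fin m → A) : χ (y, z) = ∑ i, φ i (y i) + ∑ j, ψ j (z j) := by
      have h1 : χ (y, 0) = ∑ i, φ i (y i) := by
        change ((toHom χ).comp (AddMonoidHom.inl _ _)) y = _
        conv_lhs => rw [← Finset.univ_sum_single y, map_sum]
        rfl
      have h2 : χ (0, z) = ∑ j, ψ j (z j) := by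
        change ((toHom χ).comp (AddMonoidHom.inr _ _)) z = _
        conv_lhs => rw [← Finset.univ_sum_single z, map_sum]
        rfl
      rw [← h1, ← h2, ← map_add]
      simp
    have hφ (i : Fin n) : map d (φ i) = -∑ j, MulOpposite.op (a j i) • ψ j := by
      refine CharacterDual.ext fun y => ?_
      have := hχ _ ⟨Pi.single i y, rfl⟩
      change χ (_, _) = 0 at this
      rw [hχφ, Finset.sum_eq_single i (by intro k _ hk; simp [hk]) (by simp)] at this
      have h3 (j : Fin m) : ∑ k, a j k • (Pi.single i y : Fin n → A) k = a j i • y := by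
        rw [Finset.sum_eq_single i (by intro k _ hk; simp [hk]) (by simp)]; simp
      simp only [h3, Pi.single_eq_same] at this
      simpa using eq_neg_of_add_eq_zero_left this
    apply hχx
    rw [hχφ]
    have he (i : Fin n) : e (x i) = 0 := LinearMap.congr_fun hf _
    -- The `t` term dies since `e (x i) = 0`. Linearity of `s` moves the coefficients onto `x i`, so
    -- summing over `i` produces the relations `hx`.
    have h4 (i : Fin n) : φ i (x i) = -∑ j, s (ψ j) (a j i • x i) := by
      rw [hst (φ i), hφ]
      simp [he]
    simp only [h4, Pi.zero_apply, map_zero, Finset.sum_const_zero, add_zero,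
      Finset.sum_neg_distrib]
    rw [Finset.sum_comm]
    simp [← map_sum, hx]
  obtain ⟨y, hy⟩ := key
  have hy1 (i : Fin n) : d (y i) = x i := congrFun (congrArg Prod.fst hy) i
  have hy2 (j : Fin m) : ∑ i, a j i • y i = 0 := congrFun (congrArg Prod.snd hy) j
  let g₀ : (Fin n → R) →ₗ[R] A :=
    { toFun v := ∑ i, v i • y i
      map_add' v w := by simp [add_smul, Finset.sum_add_distrib]
      map_smul' c v := by simp [mul_smul, Finset.smul_sum] }
  have hg₀ : LinearMap.ker p ≤ LinearMap.ker g₀ := by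
    intro v hv
    obtain ⟨w, rfl⟩ := (hrp v).1 hv
    have : g₀ ∘ₗ r = 0 := LinearMap.pi_ext' fun j => LinearMap.ext_ring (hy2 j)
    exact LinearMap.congr_fun this w
  let g := (LinearMap.ker p).liftQ g₀ hg₀ ∘ₗ (p.quotKerEquivOfSurjective hp).symm.toLinearMap
  have hg (v : Fin n → R) : g (p v) = g₀ v := by
    have : (p.quotKerEquivOfSurjective hp).symm (p v) = Submodule.Quotient.mk v := by
      rw [LinearEquiv.symm_apply_eq]; rfl
    simp [g, this]
  refine ⟨g, LinearMap.ext fun z => ?_⟩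
  obtain ⟨v, rfl⟩ := hp z
  rw [LinearMap.comp_apply, hg, hp_eq]
  simp [g₀, hy1, x]

end CharacterDual

/-! ### Injectivity of `ℚ/ℤ` and exactness of the character dual -/

section CharacterDualFunctor

variable (R : Type u) [Ring R]

/-- The contravariant functor `N ↦ Hom_ℤ(N, ℚ/ℤ)` from left to right modules. -/
def characterDualFunctor : ModuleCat.{u} R ⥤ (ModuleCat.{u} Rᵐᵒᵖ)ᵒᵖ where
  obj N := Opposite.op (ModuleCat.of Rᵐᵒᵖ (CharacterDual N))
  map f := (ModuleCat.ofHom (CharacterDual.map f.hom)).op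
  map_id _ := rfl
  map_comp _ _ := rfl

instance : (characterDualFunctor R).Additive where
  map_add {N N' f g} := by
    refine Quiver.Hom.unop_inj (ModuleCat.hom_ext (LinearMap.ext fun φ => ?_))
    exact CharacterDual.ext fun x => map_add (show CharacterDual N' from φ) (f x) (g x)

instance : Injective (AddCommGrpCat.of RatCircle.{u}) := by
  have : DivisibleBy RatCircle.{u} ℤ :=
    { div x n := ULift.up (DivisibleBy.div x.down n)
      div_zero x := ULift.ext _ _ (DivisibleBy.div_zero x.down)
      div_cancel {n} x hn := ULift.ext _ _ (DivisibleBy.div_cancel x.down hn) }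
  exact AddCommGrpCat.injective_of_divisible _

variable {R}

/-- Characters extend along homomorphisms whose kernel they vanish on. -/
lemma CharacterDual.exists_extension {A B : Type u} [AddCommGroup A] [AddCommGroup B]
    (g : A →+ B) (φ : CharacterDual A) (hφ : ∀ x, g x = 0 → φ x = 0) :
    ∃ ψ : CharacterDual B, ∀ x, ψ (g x) = φ x := by
  let g' := AddCommGrpCat.ofHom (QuotientAddGroup.kerLift g)
  have : Mono g' := (AddCommGrpCat.mono_iff_injective _).2 (QuotientAddGroup.kerLift_injective g)
  let φ' := AddCommGrpCat.ofHom (QuotientAddGroup.lift g.ker (toHom φ) hφ)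
  refine ⟨toHom.symm (Injective.factorThru φ' g').hom, fun x => ?_⟩
  exact ConcreteCategory.congr_hom (Injective.comp_factorThru φ' g') (QuotientAddGroup.mk x)

/-- The character dual of an acyclic complex is acyclic. -/
lemma acyclic_characterDual {F : CochainComplex (ModuleCat.{u} R) ℤ} (hF : F.Acyclic) :
    (((characterDualFunctor R).mapHomologicalComplex _).obj F).Acyclic := by
  intro n
  have h := hF n
  rw [HomologicalComplex.exactAt_iff' _ (n - 1) n (n + 1) (by simp) (by simp)] at h ⊢
  rw [← ShortComplex.exact_unop_iff, ShortComplex.moduleCat_exact_iff]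
  rw [ShortComplex.moduleCat_exact_iff] at h
  intro φ hφ
  obtain ⟨ψ, hψ⟩ := CharacterDual.exists_extension (F.d n (n + 1)).hom.toAddMonoidHom φ
    (fun x hx => by
      obtain ⟨y, rfl⟩ := h x hx
      exact DFunLike.congr_fun (F := CharacterDual (F.X (n - 1))) hφ y)
  exact ⟨ψ, CharacterDual.ext hψ⟩

end CharacterDualFunctor

/-! ### Tensor-Hom adjunction for pairings into `ℚ/ℤ` -/

section Pairing

variable {R : Type u} [Ring R]

/-- A homomorphism `M → Hom_ℤ(N, ℚ/ℤ)` of right modules, as a homomorphism `M ⊗_R N → ℚ/ℤ`. -/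
def BalancedTensor.uncurry {M N : Type u} [AddCommGroup M] [Module Rᵐᵒᵖ M] [AddCommGroup N]
    [Module R N] (f : M →ₗ[Rᵐᵒᵖ] CharacterDual N) : BalancedTensor R M N →+ RatCircle.{u} :=
  QuotientAddGroup.lift _ (TensorProduct.liftAddHom
      (CharacterDual.toHom.toAddMonoidHom.comp f.toAddMonoidHom) (fun r m n => by
        simp))
    ((AddSubgroup.closure_le _).2 (by
      rintro _ ⟨m, r, n, rfl⟩
      simp))

/-- A homomorphism `M ⊗_R N → ℚ/ℤ`, as a homomorphism `M → Hom_ℤ(N, ℚ/ℤ)` of right modules. -/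
def BalancedTensor.curry {M N : Type u} [AddCommGroup M] [Module Rᵐᵒᵖ M] [AddCommGroup N]
    [Module R N] (χ : BalancedTensor R M N →+ RatCircle.{u}) : M →ₗ[Rᵐᵒᵖ] CharacterDual N where
  toFun m := CharacterDual.toHom.symm
    { toFun n := χ (QuotientAddGroup.mk (m ⊗ₜ[ℤ] n))
      map_zero' := by rw [TensorProduct.tmul_zero]; exact map_zero χ
      map_add' n n' := by
        rw [TensorProduct.tmul_add]
        exact map_add χ (QuotientAddGroup.mk _) (QuotientAddGroup.mk _) }
  map_add' m m' := by
    refine CharacterDual.ext fun n => ?_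
    change χ (QuotientAddGroup.mk ((m + m') ⊗ₜ[ℤ] n)) = _
    rw [TensorProduct.add_tmul]
    exact map_add χ (QuotientAddGroup.mk _) (QuotientAddGroup.mk _)
  map_smul' r m := by
    refine CharacterDual.ext fun n => congrArg χ (QuotientAddGroup.eq.2 ?_)
    rw [← neg_mem_iff]
    refine AddSubgroup.subset_closure ⟨m, r.unop, n, ?_⟩
    simp [sub_eq_add_neg, add_comm]

open HomologicalComplex Limits in
/-- The differential of the total complex of a bifunctor, on a summand. -/
lemma ιMapBifunctor_comp_d_comp {C₁ C₂ D : Type*} [Category* C₁] [Category* C₂] [Category* D]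
    [HasZeroMorphisms C₁] [HasZeroMorphisms C₂] [Preadditive D]
    (K : CochainComplex C₁ ℤ) (F : CochainComplex C₂ ℤ) (T : C₁ ⥤ C₂ ⥤ D)
    [T.PreservesZeroMorphisms] [∀ X, (T.obj X).PreservesZeroMorphisms]
    [HasMapBifunctor K F T (ComplexShape.up ℤ)] {Z : D} (p q m m' : ℤ) (hpq : p + q = m)
    (hm : m + 1 = m') (ξ : (mapBifunctor K F T (ComplexShape.up ℤ)).X m' ⟶ Z) :
    ιMapBifunctor K F T (ComplexShape.up ℤ) p q m hpq ≫
        (mapBifunctor K F T (ComplexShape.up ℤ)).d m m' ≫ ξ =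
      (T.map (K.d p (p + 1))).app (F.X q) ≫
        ιMapBifunctor K F T (ComplexShape.up ℤ) (p + 1) q m' (show p + 1 + q = m' by lia) ≫ ξ +
      p.negOnePow • (T.obj (K.X p)).map (F.d q (q + 1)) ≫
        ιMapBifunctor K F T (ComplexShape.up ℤ) p (q + 1) m' (show p + (q + 1) = m' by lia) ≫ ξ := by
  rw [mapBifunctor.d_eq, Preadditive.add_comp, Preadditive.comp_add,
    mapBifunctor.ι_D₁_assoc, mapBifunctor.ι_D₂_assoc,
    mapBifunctor.d₁_eq _ _ _ _ (show (ComplexShape.up ℤ).Rel p (p + 1) from rfl) q m'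
      (show p + 1 + q = m' by lia),
    mapBifunctor.d₂_eq _ _ _ _ p (show (ComplexShape.up ℤ).Rel q (q + 1) from rfl) m'
      (show p + (q + 1) = m' by lia)]
  change ((1 : ℤˣ) • _) ≫ ξ + (p.negOnePow • _) ≫ ξ = _
  simp [Linear.units_smul_comp]

open HomologicalComplex in
/-- If `K ⊗_R F` is exact in degree `n`, a family of pairings of total degree `n` with vanishing
coboundary is the coboundary of a family of pairings of total degree `n + 1`. -/
lemma exists_pairing_of_exactAt {K : CochainComplex (ModuleCat.{u} Rᵐᵒᵖ) ℤ}
    {F : CochainComplex (ModuleCat.{u} R) ℤ} {n : ℤ} (h : (tensorComplex K F).ExactAt n)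
    (b : ∀ p q : ℤ, p + q = n → (K.X p →ₗ[Rᵐᵒᵖ] CharacterDual (F.X q)))
    (hb : ∀ (p q : ℤ) (hpq : p + q + 1 = n) (x : K.X p) (y : F.X q),
      b (p + 1) q (by lia) (K.d p (p + 1) x) y +
        p.negOnePow • b p (q + 1) (by lia) x (F.d q (q + 1) y) = 0) :
    ∃ c : ∀ p q : ℤ, p + q = n + 1 → (K.X p →ₗ[Rᵐᵒᵖ] CharacterDual (F.X q)),
      ∀ (p q : ℤ) (hpq : p + q = n) (x : K.X p) (y : F.X q),
        b p q hpq x y = c (p + 1) q (by lia) (K.d p (p + 1) x) y +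
          p.negOnePow • c p (q + 1) (by lia) x (F.d q (q + 1) y) := by
  unfold tensorComplex at h
  rw [exactAt_iff' _ (n - 1) n (n + 1) (by simp) (by simp)] at h
  let T := balancedTensorFunctor R
  obtain ⟨χ, hι⟩ : ∃ χ : (mapBifunctor K F T (ComplexShape.up ℤ)).X n ⟶
      AddCommGrpCat.of RatCircle.{u}, ∀ (p q : ℤ) (hpq : p + q = n),
        ιMapBifunctor K F T (ComplexShape.up ℤ) p q n hpq ≫ χ =
          AddCommGrpCat.ofHom (BalancedTensor.uncurry (b p q hpq)) :=
    ⟨mapBifunctorDesc fun p q hpq => AddCommGrpCat.ofHom (BalancedTensor.uncurry (b p q hpq)),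
      fun p q hpq => ι_mapBifunctorDesc _ p q hpq⟩
  have hχ : (mapBifunctor K F T (ComplexShape.up ℤ)).d (n - 1) n ≫ χ = 0 := by
    refine mapBifunctor.hom_ext fun p q hpq => ?_
    replace hpq : p + q = n - 1 := hpq
    rw [ιMapBifunctor_comp_d_comp K F T p q (n - 1) n hpq (by lia), Limits.comp_zero,
      hι, hι]
    ext : 1
    exact BalancedTensor.hom_ext fun x y => hb p q (by lia) x y
  -- By exactness `χ` factors through the image of `d`, and it extends from there because `ℚ/ℤ` is
  -- injective.
  obtain ⟨ξ, hξ⟩ : ∃ ξ, (mapBifunctor K F T (ComplexShape.up ℤ)).d n (n + 1) ≫ ξ = χ :=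
    ⟨h.descToInjective χ hχ, h.comp_descToInjective χ hχ⟩
  refine ⟨fun p q hpq => BalancedTensor.curry
    (ιMapBifunctor K F T (ComplexShape.up ℤ) p q (n + 1) hpq ≫ ξ).hom, fun p q hpq x y => ?_⟩
  have := ιMapBifunctor_comp_d_comp K F T p q n (n + 1) hpq rfl ξ
  rw [hξ, hι] at this
  exact ConcreteCategory.congr_hom this (QuotientAddGroup.mk (x ⊗ₜ[ℤ] y))

end Pairing

/-! ### K-injectivity of the character dual -/

section KInjective

variable {R : Type u} [Ring R]

/-- The complex of characters of a complex of left modules. -/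
noncomputable def characterDualComplex (F : CochainComplex (ModuleCat.{u} R) ℤ) :
    CochainComplex (ModuleCat.{u} Rᵐᵒᵖ) ℤ :=
  ((CochainComplex.opEquivalence _).inverse.obj
    (((characterDualFunctor R).mapHomologicalComplex _).obj F)).unop

lemma Int.negOnePow_triangular_succ (p : ℤ) :
    ((p + 1) * (p + 1 + 1) / 2).negOnePow = (p + 1).negOnePow * (p * (p + 1) / 2).negOnePow := by
  rw [← Int.negOnePow_add]
  congr 1
  rw [show (p + 1) * (p + 1 + 1) = p * (p + 1) + (p + 1) * 2 by ring,
    Int.add_mul_ediv_right _ _ two_ne_zero, add_comm]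

lemma CharacterDual.units_smul_apply {N : Type u} [AddCommGroup N] (ε : ℤˣ) (φ : CharacterDual N)
    (x : N) : (ε • φ) x = ε • φ x := by
  rcases Int.units_eq_one_or ε with rfl | rfl <;> simp

/-- If `- ⊗_R F` preserves acyclicity, then the complex of characters of `F` is K-injective. -/
lemma isKInjective_characterDualComplex {F : CochainComplex (ModuleCat.{u} R) ℤ}
    (hF : ∀ K : CochainComplex (ModuleCat.{u} Rᵐᵒᵖ) ℤ, K.Acyclic → (tensorComplex K F).Acyclic) :
    (characterDualComplex F).IsKInjective where
  nonempty_homotopy_zero {K} f hK := by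
    -- The dual complex carries no signs while the tensor differential carries `(-1)^p`. Rescaling
    -- by `ε` reconciles them: the cocycle condition for `ε p • f' p` requires exactly `ε (p + 1) =
    -- -(-1)^p ε p`.
    let ε (p : ℤ) : ℤˣ := (p * (p + 1) / 2).negOnePow
    have hε (p : ℤ) : ε (p + 1) = (p + 1).negOnePow * ε p := Int.negOnePow_triangular_succ p
    let f' (p : ℤ) : K.X p →ₗ[Rᵐᵒᵖ] CharacterDual (F.X (-p)) := (f.f p).hom
    have hf' (p : ℤ) (x : K.X p) (y : F.X (-(p + 1))) :
        f' (p + 1) (K.d p (p + 1) x) y = f' p x (F.d (-(p + 1)) (-p) y) :=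
      DFunLike.congr_fun (F := CharacterDual (F.X (-(p + 1))))
        (ConcreteCategory.congr_hom (f.comm p (p + 1)).symm x) y
    let b (p q : ℤ) (hpq : p + q = 0) : K.X p →ₗ[Rᵐᵒᵖ] CharacterDual (F.X q) :=
      ε p • CharacterDual.map (F.XIsoOfEq (show q = -p by lia)).hom.hom ∘ₗ f' p
    have hb (p q : ℤ) (hpq : p + q = 0) (x : K.X p) (y : F.X q) :
        b p q hpq x y = ε p • f' p x ((F.XIsoOfEq (show q = -p by lia)).hom y) :=
      CharacterDual.units_smul_apply _ _ _
    obtain ⟨c, hc⟩ := exists_pairing_of_exactAt (hF K hK 0) b (fun p q hpq x y => by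
      obtain rfl : q = -(p + 1) := by lia
      have hd : (F.XIsoOfEq (show -(p + 1) + 1 = -p by lia)).hom
          (F.d (-(p + 1)) (-(p + 1) + 1) y) = F.d (-(p + 1)) (-p) y :=
        ConcreteCategory.congr_hom (F.d_comp_XIsoOfEq_hom _ _) y
      rw [hb (p + 1) _ (by lia), hb p _ (by lia), hd, hε, Int.negOnePow_succ]
      simp only [HomologicalComplex.XIsoOfEq_rfl, Iso.refl_hom, ModuleCat.id_apply]
      rw [hf', neg_mul, Units.neg_smul, mul_smul, neg_add_cancel])
    have hc₁ (p q q' : ℤ) (hpq : p + q = 0) (hq : q + 1 = q') (x : K.X p) (y : F.X q) :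
        b p q hpq x y = c (p + 1) q (by lia) (K.d p (p + 1) x) y +
          p.negOnePow • c p q' (by lia) x (F.d q q' y) := by
      subst hq
      exact hc p q hpq x y
    have hc' (p : ℤ) (x : K.X p) (y : F.X (-p)) :
        f' p x y = (ε p • c (p + 1) (-p) (by lia)) (K.d p (p + 1) x) y +
          (ε (p - 1) • c p (-(p - 1)) (by lia)) x (F.d (-p) (-(p - 1)) y) := by
      have h := hc₁ p (-p) (-(p - 1)) (by lia) (by lia) x y
      rw [hb p _ (by lia)] at h
      have h2 := congrArg (fun z => ε p • z) h
      have h3 : ε p = p.negOnePow * ε (p - 1) := by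
        have := hε (p - 1)
        rwa [sub_add_cancel] at this
      have h4 : ε p * p.negOnePow = ε (p - 1) := by
        rw [h3, mul_comm, ← mul_assoc, Int.units_mul_self, one_mul]
      simp only [smul_smul, Int.units_mul_self, one_smul, smul_add, h4] at h2
      rw [LinearMap.smul_apply, LinearMap.smul_apply, CharacterDual.units_smul_apply,
        CharacterDual.units_smul_apply, ← h2]
      simp
    -- The pairings `c` of total degree `1`, with the signs undone, are the homotopy; it is extended
    -- by zero off `q + 1 = p`.
    obtain ⟨h, hh, h₀⟩ : ∃ h : ∀ p q : ℤ, K.X p ⟶ (characterDualComplex F).X q,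
        (∀ (p q : ℤ) (hpq : q + 1 = p) (x : K.X p), h p q x = (ε q • c p (-q) (by lia)) x) ∧
        ∀ p q : ℤ, ¬ q + 1 = p → h p q = 0 := by
      suffices ∀ p q : ℤ, ∃ h : K.X p ⟶ (characterDualComplex F).X q,
          (∀ (hpq : q + 1 = p) (x : K.X p), h x = (ε q • c p (-q) (by lia)) x) ∧
          (¬ q + 1 = p → h = 0) by
        choose h hh h₀ using this
        exact ⟨h, hh, h₀⟩
      intro p q
      by_cases hpq : q + 1 = p
      · exact ⟨ModuleCat.ofHom (Y := CharacterDual (F.X (-q))) (ε q • c p (-q) (by lia)),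
          fun _ _ => rfl, fun h => (h hpq).elim⟩
      · exact ⟨0, fun h => (hpq h).elim, fun _ => rfl⟩
    refine ⟨{ hom := h, zero := h₀, comm p := ?_ }⟩
    rw [dNext_eq _ (show (ComplexShape.up ℤ).Rel p (p + 1) from rfl),
      prevD_eq _ (show (ComplexShape.up ℤ).Rel (p - 1) p by simp)]
    refine ModuleCat.hom_ext (LinearMap.ext fun x => CharacterDual.ext fun y => ?_)
    refine (hc' p x y).trans (Eq.trans ?_ (add_zero _).symm)
    exact congrArg₂ (· + ·) (DFunLike.congr_fun (F := CharacterDual (F.X (-p)))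
        (hh (p + 1) p rfl (K.d p (p + 1) x)).symm y)
      (DFunLike.congr_fun (F := CharacterDual (F.X (-(p - 1))))
        (hh p (p - 1) (by lia) x).symm (F.d (-p) (-(p - 1)) y))

end KInjective

/-! ### Contractibility of the dual of the cone, in the opposite category -/

section KProjective

variable {R : Type u} [Ring R]

open CochainComplex Opposite

lemma CochainComplex.acyclic_opEquivalence_inverse {C : Type*} [Category* C] [Abelian C]
    {L : CochainComplex Cᵒᵖ ℤ} (hL : L.Acyclic) :
    ((opEquivalence C).inverse.obj L).unop.Acyclic := by
  intro n
  have h := hL (-n)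
  rw [HomologicalComplex.exactAt_iff' _ (-(n + 1)) (-n) (-(n - 1)) (by simp; lia)
    (by simp; lia), ← ShortComplex.exact_unop_iff] at h
  rw [HomologicalComplex.exactAt_iff' _ (n - 1) n (n + 1) (by simp) (by simp)]
  exact h

/-- The opposite of a K-injective complex is K-projective. -/
lemma CochainComplex.isKProjective_op {C : Type*} [Category* C] [Abelian C]
    (K : CochainComplex C ℤ) [K.IsKInjective] :
    ((opEquivalence C).functor.obj (op K)).IsKProjective where
  nonempty_homotopy_zero {L} f hL := by
    let L' := (opEquivalence C).inverse.obj L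
    let e : (opEquivalence C).functor.obj L' ≅ L := (opEquivalence C).counitIso.app L
    obtain ⟨g, hg⟩ := (opEquivalence C).functor.map_surjective (f ≫ e.inv)
    have hL' : L'.unop.Acyclic := acyclic_opEquivalence_inverse hL
    have h := homotopyOp (IsKInjective.homotopyZero g.unop hL')
    refine ⟨(Homotopy.ofEq ?_).trans ((h.compRight e.hom).trans (Homotopy.ofEq ?_))⟩
    · simp [hg]
    · simp

/-- The character dual of a semi-flat complex is K-projective in the opposite category. -/
lemma isKProjective_characterDual {F : CochainComplex (ModuleCat.{u} R) ℤ} (hF : IsSemiFlat F) :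
    IsKProjective (((characterDualFunctor R).mapHomologicalComplex (ComplexShape.up ℤ)).obj F) := by
  have := isKInjective_characterDualComplex hF.acyclic_tensor
  have h := isKProjective_op (characterDualComplex F)
  exact @isKProjective_of_iso _ _ _ _ _ ((opEquivalence _).counitIso.app
    (((characterDualFunctor R).mapHomologicalComplex (ComplexShape.up ℤ)).obj F)) h

/-- Mapping cones of K-projective complexes are K-projective. -/
lemma CochainComplex.isKProjective_mappingCone {C : Type*} [Category* C] [Abelian C]
    {K L : CochainComplex C ℤ} (f : K ⟶ L) [hK : K.IsKProjective] [hL : L.IsKProjective] :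
    (mappingCone f).IsKProjective := by
  rw [isKProjective_iff_leftOrthogonal] at hK hL ⊢
  -- K-projectives are the left orthogonal of the acyclics, so they are closed under third vertices
  -- of triangles.
  exact ObjectProperty.ext_of_isTriangulatedClosed₃ _ _
    (HomotopyCategory.mappingCone_triangleh_distinguished f) hK hL

/-- The mapping cone of a quasi-isomorphism is acyclic. -/
lemma CochainComplex.acyclic_mappingCone {C : Type*} [Category* C] [Abelian C]
    {K L : CochainComplex C ℤ} (f : K ⟶ L) [hf : QuasiIso f] : (mappingCone f).Acyclic := by
  have h : HomologicalComplex.quasiIso C (ComplexShape.up ℤ) f := hf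
  rw [← HomotopyCategory.quotient_obj_mem_subcategoryAcyclic_iff_acyclic]
  rw [← HomotopyCategory.quotient_map_mem_quasiIso_iff,
    HomotopyCategory.quasiIso_eq_trW_subcategoryAcyclic] at h
  exact (ObjectProperty.trW_iff_of_distinguished _ _
    (HomotopyCategory.mappingCone_triangleh_distinguished f)).1 h

/-- The characters of the mapping cone of a quasi-isomorphism of semi-flat complexes form a
contractible complex. -/
lemma nonempty_contraction_characterDual_mappingCone {F F' : CochainComplex (ModuleCat.{u} R) ℤ}
    (hF : IsSemiFlat F) (hF' : IsSemiFlat F') (α : F ⟶ F') [QuasiIso α] :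
    Nonempty (Homotopy (𝟙 (((characterDualFunctor R).mapHomologicalComplex
      (ComplexShape.up ℤ)).obj (mappingCone α))) 0) := by
  have := isKProjective_characterDual hF
  have := isKProjective_characterDual hF'
  have := isKProjective_mappingCone
    (((characterDualFunctor R).mapHomologicalComplex (ComplexShape.up ℤ)).map α)
  have := isKProjective_of_iso (mappingCone.mapHomologicalComplexIso α (characterDualFunctor R)).symm
  exact IsKProjective.nonempty_homotopy_zero _ (acyclic_characterDual (acyclic_mappingCone α))

/-- A homomorphism from a finitely presented module to the cycles of the mapping cone of a
quasi-isomorphism of semi-flat complexes lifts along the differential. -/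
lemma exists_lift_mappingCone {F F' : CochainComplex (ModuleCat.{u} R) ℤ}
    (hF : IsSemiFlat F) (hF' : IsSemiFlat F') (α : F ⟶ F') [QuasiIso α] {N : ModuleCat.{u} R}
    [Module.FinitePresentation R N] {i j k : ℤ} (hij : i + 1 = j) (hjk : j + 1 = k)
    (f : N ⟶ (mappingCone α).X j) (hf : f ≫ (mappingCone α).d j k = 0) :
    ∃ g : N ⟶ (mappingCone α).X i, g ≫ (mappingCone α).d i j = f := by
  obtain ⟨H⟩ := nonempty_contraction_characterDual_mappingCone hF hF' α
  have hcomm := congrArg Quiver.Hom.unop (H.comm j)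
  rw [dNext_eq _ (show (ComplexShape.up ℤ).Rel j k from hjk),
    prevD_eq _ (show (ComplexShape.up ℤ).Rel i j from hij), HomologicalComplex.zero_f,
    add_zero, unop_add, unop_comp, unop_comp] at hcomm
  obtain ⟨g, hg⟩ := exists_lift_of_characterDual_contraction ((mappingCone α).d i j).hom
    ((mappingCone α).d j k).hom (H.hom j i).unop.hom (H.hom k j).unop.hom
    (fun φ => by
      have h := ConcreteCategory.congr_hom hcomm φ
      exact h.trans (add_comm _ _))
    f.hom (congrArg ModuleCat.Hom.hom hf)
  exact ⟨ModuleCat.ofHom g, ModuleCat.hom_ext hg⟩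

end KProjective

/-! ### Quasi-isomorphisms of abelian groups by elements -/

section QuasiIsoCriterion

/-- A morphism of complexes of abelian groups is a quasi-isomorphism if it is injective and
surjective on cohomology, in terms of elements. -/
lemma CochainComplex.quasiIso_of_injective_of_surjective {K L : CochainComplex AddCommGrpCat.{u} ℤ}
    (f : K ⟶ L)
    (hinj : ∀ (i j k : ℤ), i + 1 = j → j + 1 = k → ∀ (x : K.X j) (y : L.X i), K.d j k x = 0 →
      f.f j x = L.d i j y → ∃ x' : K.X i, K.d i j x' = x)
    (hsurj : ∀ (i j k : ℤ), i + 1 = j → j + 1 = k → ∀ y : L.X j, L.d j k y = 0 →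
      ∃ (x : K.X j) (y' : L.X i), K.d j k x = 0 ∧ f.f j x = y + L.d i j y') :
    QuasiIso f := by
  have hπ (M : CochainComplex AddCommGrpCat.{u} ℤ) (j : ℤ) :
      Function.Surjective (M.homologyπ j) := (AddCommGrpCat.epi_iff_surjective _).1 inferInstance
  have hi (M : CochainComplex AddCommGrpCat.{u} ℤ) (j : ℤ) :
      Function.Injective (M.iCycles j) := (AddCommGrpCat.mono_iff_injective _).1 inferInstance
  have hd (M : CochainComplex AddCommGrpCat.{u} ℤ) (i j : ℤ) (x : M.X i) :
      M.iCycles j (M.toCycles i j x) = M.d i j x :=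
    ConcreteCategory.congr_hom (M.toCycles_i i j) x
  have hdi (M : CochainComplex AddCommGrpCat.{u} ℤ) (i j : ℤ) (z : M.cycles i) :
      M.d i j (M.iCycles i z) = 0 :=
    ConcreteCategory.congr_hom (M.iCycles_d i j) z
  have hdπ (M : CochainComplex AddCommGrpCat.{u} ℤ) (i j : ℤ) (x : M.X i) :
      M.homologyπ j (M.toCycles i j x) = 0 :=
    ConcreteCategory.congr_hom (M.toCycles_comp_homologyπ i j) x
  have hker (M : CochainComplex AddCommGrpCat.{u} ℤ) (i j : ℤ) (hij : i + 1 = j) (z : M.cycles j)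
      (hz : M.homologyπ j z = 0) : ∃ x : M.X i, M.toCycles i j x = z :=
    (ShortComplex.ab_exact_iff _).1 (ShortComplex.exact_of_g_is_cokernel
      (ShortComplex.mk (M.toCycles i j) (M.homologyπ j) (M.toCycles_comp_homologyπ i j))
      (M.homologyIsCokernel i j (by simp [← hij]))) z hz
  have hcyc (j : ℤ) (z : K.cycles j) :
      L.iCycles j (HomologicalComplex.cyclesMap f j z) = f.f j (K.iCycles j z) :=
    ConcreteCategory.congr_hom (HomologicalComplex.cyclesMap_i f j) z
  have hhom (j : ℤ) (z : K.cycles j) : HomologicalComplex.homologyMap f j (K.homologyπ j z) =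
      L.homologyπ j (HomologicalComplex.cyclesMap f j z) :=
    ConcreteCategory.congr_hom (HomologicalComplex.homologyπ_naturality f j) z
  refine ⟨fun j => ?_⟩
  rw [quasiIsoAt_iff_isIso_homologyMap, ConcreteCategory.isIso_iff_bijective]
  constructor
  · rw [injective_iff_map_eq_zero]
    intro h hh
    obtain ⟨z, rfl⟩ := hπ K j h
    rw [hhom] at hh
    obtain ⟨y, hy⟩ := hker L (j - 1) j (by lia) _ hh
    obtain ⟨x', hx'⟩ := hinj (j - 1) j (j + 1) (by lia) rfl (K.iCycles j z) y (hdi K j (j + 1) z)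
      (by rw [← hcyc, ← hy, hd])
    have : K.toCycles (j - 1) j x' = z := hi K j ((hd K _ _ _).trans hx')
    rw [← this, hdπ]
  · intro h
    obtain ⟨w, rfl⟩ := hπ L j h
    obtain ⟨x, y', hx, hxy⟩ := hsurj (j - 1) j (j + 1) (by lia) rfl (L.iCycles j w)
      (hdi L j (j + 1) w)
    obtain ⟨z, hz⟩ : ∃ z : K.cycles j, K.iCycles j z = x :=
      (ShortComplex.ab_exact_iff _).1 (ShortComplex.exact_of_f_is_kernel
        (ShortComplex.mk (K.iCycles j) (K.d j (j + 1)) (K.iCycles_d j (j + 1)))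
        (K.cyclesIsKernel j (j + 1) (by simp))) x hx
    refine ⟨K.homologyπ j z, ?_⟩
    have : HomologicalComplex.cyclesMap f j z = w + L.toCycles (j - 1) j y' :=
      hi L j (by rw [hcyc, hz, hxy, map_add, hd])
    rw [hhom, this, map_add, hdπ, add_zero]

end QuasiIsoCriterion

/-! ### Total Hom from bounded complexes and the main theorem -/

section HomComplexMap

open CochainComplex HomComplex

variable {R : Type u} [Ring R]

/-- If homomorphisms from the modules of a bounded complex `N` to the cycles of `C` lift along the
differential of `C`, then cocycles from `N` to `C` are coboundaries. -/
lemma exists_δ_eq_of_exists_lift {N C : CochainComplex (ModuleCat.{u} R) ℤ}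
    (hN : IsBoundedComplex N)
    (hC : ∀ (p i j k : ℤ), i + 1 = j → j + 1 = k → ∀ f : N.X p ⟶ C.X j, f ≫ C.d j k = 0 →
      ∃ g : N.X p ⟶ C.X i, g ≫ C.d i j = f)
    {m n n' : ℤ} (hmn : m + 1 = n) (hnn' : n + 1 = n') (z : Cochain N C n) (hz : δ n n' z = 0) :
    ∃ w : Cochain N C m, δ m n w = z := by
  obtain ⟨a, b, hab⟩ := hN
  have key (k : ℕ) : ∃ w : Cochain N C m, ∀ (p q : ℤ) (hpq : p + n = q), b < p + k →
      (z - δ m n w).v p q hpq = 0 := by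
    induction k with
    | zero =>
      exact ⟨0, fun p q hpq hp => (hab p (Or.inr (by simpa using hp))).eq_of_src _ _⟩
    | succ k ih =>
      obtain ⟨w, hw⟩ := ih
      have hz' : δ n n' (z - δ m n w) = 0 := by rw [δ_sub, hz, δ_δ, sub_zero]
      let s := b - k
      -- At the next degree down, `s`, the components of `z - δ w` above `s` vanish, so the cocycle
      -- condition puts its `s`-component in the cycles of `C`.
      have hs := Cochain.congr_v hz' s (s + n') rfl
      rw [δ_v n n' hnn' _ s (s + n') rfl (s + n) (s + 1) (by lia) rfl,
        hw (s + 1) (s + n') (by lia) (by lia), Limits.comp_zero, smul_zero, add_zero] at hs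
      obtain ⟨g, hg⟩ := hC s (s + m) (s + n) (s + n') (by lia) (by lia) _ hs
      refine ⟨w + Cochain.single g m, fun p q hpq hp => ?_⟩
      -- `δ (single g)` lives only in degrees `s` and `s - 1`, so the correction preserves the
      -- vanishing above `s`.
      rw [δ_add, ← sub_sub, Cochain.sub_v,
        δ_v m n hmn (Cochain.single g m) p q hpq (p + m) (p + 1) (by lia) rfl,
        Cochain.single_v_eq_zero _ _ _ _ _ (show p + 1 ≠ s by grind),
        Limits.comp_zero, smul_zero, add_zero]
      by_cases hps : p = s
      · subst hpq
        subst hps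
        rw [Cochain.single_v, hg, sub_self]
      · rw [Cochain.single_v_eq_zero _ _ _ _ _ hps, Limits.zero_comp, sub_zero,
          hw p q hpq (by grind)]
  obtain ⟨w, hw⟩ := key (b + 1 - a).toNat
  refine ⟨w, (sub_eq_zero.1 (Cochain.ext _ _ fun p q hpq => ?_)).symm⟩
  by_cases hp : p < a
  · exact (hab p (Or.inl hp)).eq_of_src _ _
  · exact hw p q hpq (by lia)

end HomComplexMap

open CochainComplex HomComplex in
theorem mainTheorem9 {R : Type u} [Ring R] {F F' : CochainComplex (ModuleCat.{u} R) ℤ}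
    (hF : IsSemiFlat F) (hF' : IsSemiFlat F') (α : F ⟶ F') (hα : QuasiIso α)
    (N : CochainComplex (ModuleCat.{u} R) ℤ) (hbdd : IsBoundedComplex N)
    (hfp : ∀ n : ℤ, Module.FinitePresentation R (N.X n)) :
    QuasiIso (homComplexMap N α) := by
  -- A degree `l` cochain into the cone is a pair `(x, y)`; the hypotheses say it is a cocycle and
  -- the conclusion that it bounds `(x', y')`.
  have hlift {l m n : ℤ} (hlm : l + 1 = m) (hmn : m + 1 = n) (x : Cochain N F m)
      (y : Cochain N F' l) (hx : δ m n x = 0)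
      (hxy : δ l m y + x.comp (Cochain.ofHom α) (add_zero m) = 0) :
      ∃ (x' : Cochain N F l) (y' : Cochain N F' (l - 1)), δ l m x' = -x ∧
        δ (l - 1) l y' + x'.comp (Cochain.ofHom α) (add_zero l) = y := by
    obtain ⟨w, hw⟩ := exists_δ_eq_of_exists_lift (C := mappingCone α) hbdd
      (fun p i j k hij hjk f hf =>
        have := hfp p
        exists_lift_mappingCone hF hF' α hij hjk f hf)
      (sub_add_cancel l 1) hlm (mappingCone.liftCochain α x y hlm)
      (by rw [mappingCone.δ_liftCochain _ _ _ _ n hmn, hx, hxy]; simp)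
    obtain ⟨x', y', rfl⟩ : ∃ (x' : Cochain N F l) (y' : Cochain N F' (l - 1)),
        w = mappingCone.liftCochain α x' y' (sub_add_cancel l 1) :=
      ⟨w.comp (mappingCone.fst α).1 (sub_add_cancel l 1), w.comp (mappingCone.snd α) (add_zero _),
        by rw [mappingCone.ext_cochain_to_iff α _ _ (sub_add_cancel l 1)]; simp⟩
    rw [mappingCone.δ_liftCochain _ _ _ _ m hlm, ← Cochain.neg_comp] at hw
    replace hw : mappingCone.liftCochain α (-δ l m x')
      (δ (l - 1) l y' + x'.comp (Cochain.ofHom α) (add_zero l)) hlm =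
        mappingCone.liftCochain α x y hlm := hw
    have h₁ := congrArg (fun v => Cochain.comp v (mappingCone.fst α).1 hlm) hw
    have h₂ := congrArg (fun v => Cochain.comp v (mappingCone.snd α) (add_zero _)) hw
    simp only [mappingCone.liftCochain_fst, mappingCone.liftCochain_snd] at h₁ h₂
    exact ⟨x', y', by rw [← h₁, neg_neg], h₂⟩
  refine quasiIso_of_injective_of_surjective _ ?_ ?_
  · intro i j k hij hjk (x : Cochain N F j) (y : Cochain N F' i) (hx : δ j k x = 0)
      (hxy : x.comp (Cochain.ofHom α) (add_zero j) = δ i j y)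
    -- Injectivity comes from the cone cocycle `(x, -y)`, surjectivity below from `(0, y)`.
    obtain ⟨x', y', hx', -⟩ := hlift hij hjk x (-y) hx (by rw [hxy, δ_neg, neg_add_cancel])
    exact ⟨-x', show δ i j (-x') = x by rw [δ_neg, hx', neg_neg]⟩
  · intro i j k hij hjk (y : Cochain N F' j) (hy : δ j k y = 0)
    obtain ⟨x', y', hx', hy'⟩ := hlift hjk rfl 0 y (by simp) (by simpa using hy)
    obtain rfl : i = j - 1 := by lia
    refine ⟨x', -y', show δ j k x' = 0 by rw [hx', neg_zero],
      show x'.comp (Cochain.ofHom α) (add_zero j) = y + δ (j - 1) j (-y') from ?_⟩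
    rw [← hy', δ_neg]
    abel
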